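/- Let $\Gamma$ be a countably infinite connected graph with symmetric weights $\mu_{x,y}=\mu_{y,x}\ge 0$, where $\mu_{x,y}>0$ exactly when $x\sim y$ (loops are allowed), such that $\mu(x)=\sum_{y}\mu_{x,y}<\infty$ for every vertex $x$. Let $(X_n)$ be the random walk with transition probabilities $P(x,y)=\mu_{x,y}/\mu(x)$, let $d$ be the graph distance, $B(x,R)=\{y: d(x,y)<R\}$, $V(x,R)=\sum_{y\in B(x,R)}\mu(y)$, let $T_A=\min\{k: X_k\notin A\}$ be the exit time from $A$, and put $E(x,R)=\mathbb{E}(T_{B(x,R)}\mid X_0=x)$ and $F(R)=\inf_{x\in\Gamma}E(x,R)$. Suppose that the following conditions hold. $(p_0)$: there is $p_0>0$ such that $P(x,y)\ge p_0$ whenever $x\sim y$. $(VD)$: there is $D_V>0$ such that $V(x,2R)\le D_V V(x,R)$ for all $x\in\Gamma$ and all real $R>0$. $(E)$: there is $C>1$ such that $E(x,R)\le C\,E(y,R)$ for all $x,y\in\Gamma$ and all real $R>0$. $(H)$: there is $H>1$ such that for all $x\in\Gamma$, all real $R>0$ and every function $u$ that is non-negative on $B(x,2R)$ and on all neighbours of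 its points and is harmonic in $B(x,2R)$ (that is, $\sum_y P(z,y)u(y)=u(z)$ for all $z\in B(x,2R)$), one has $\max_{B(x,R)}u\le H\min_{B(x,R)}u$. Then $F$ has the strong anti-doubling property: there are constants $B_F>A_F>1$ such that $F(A_F R)\ge B_F F(R)$ for all real $R\ge 1$. Moreover, for integer radii one can take $A_F=3$: there is a constant $B_F>3$ such that $F(3R)\ge B_F F(R)$ for all integers $R\ge 1$. -/

import Mathlib

open MeasureTheory ProbabilityTheory
open scoped ENNReal

/-- A connected weighted graph on the vertex set `V`: a symmetric non-negative weight function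
with finite vertex sums; `x ∼ y` is an edge exactly when `0 < weight x y` (loops are allowed, and
`SimpleGraph.fromRel` drops them, which changes neither connectedness nor distances). -/
structure WeightedGraph (V : Type*) where
  weight : V → V → ℝ
  symm : ∀ x y, weight x y = weight y x
  nonneg : ∀ x y, 0 ≤ weight x y
  summable : ∀ x, Summable (weight x)
  connected : (SimpleGraph.fromRel fun x y => 0 < weight x y).Connected

namespace WeightedGraph

/-- The adjacency relation `x ∼ y`. -/
def Adj {V : Type*} (Γ : WeightedGraph V) (x y : V) : Prop := 0 < Γ.weight x y

/-- The underlying graph, without its loops. -/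
def graph {V : Type*} (Γ : WeightedGraph V) : SimpleGraph V :=
  SimpleGraph.fromRel fun x y => 0 < Γ.weight x y

/-- The vertex measure `μ(x) = ∑_{y ∼ x} μ_{x,y}`. -/
noncomputable def mass {V : Type*} (Γ : WeightedGraph V) (x : V) : ℝ := ∑' y, Γ.weight x y

/-- The transition probability `P(x,y) = μ_{x,y} / μ(x)`. -/
noncomputable def P {V : Type*} (Γ : WeightedGraph V) (x y : V) : ℝ := Γ.weight x y / Γ.mass x

theorem mass_pos {V : Type*} [Nontrivial V] (Γ : WeightedGraph V) (x : V) : 0 < Γ.mass x := by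
  obtain ⟨y, hy⟩ := Γ.connected.preconnected.exists_adj_of_nontrivial x
  have h : 0 < Γ.weight x y := by
    rcases ((SimpleGraph.fromRel_adj _ _ _).1 hy).2 with h | h
    · exact h
    · rw [Γ.symm]; exact h
  exact (Γ.summable x).tsum_pos (Γ.nonneg x) y h

theorem P_nonneg {V : Type*} (Γ : WeightedGraph V) (x y : V) : 0 ≤ Γ.P x y :=
  div_nonneg (Γ.nonneg x y) (tsum_nonneg (Γ.nonneg x))

theorem hasSum_P {V : Type*} [Nontrivial V] (Γ : WeightedGraph V) (x : V) :
    HasSum (Γ.P x) 1 := by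
  have h := (Γ.summable x).hasSum.div_const (Γ.mass x)
  have e : (∑' y, Γ.weight x y) / Γ.mass x = 1 := div_self (Γ.mass_pos x).ne'
  rw [e] at h
  exact h

/-- The one-step distribution `P(x, ·)`. -/
noncomputable def stepPMF {V : Type*} [Nontrivial V] (Γ : WeightedGraph V) (x : V) : PMF V :=
  ⟨fun y => ENNReal.ofReal (Γ.P x y), by
    have h := ENNReal.ofReal_tsum_of_nonneg (Γ.P_nonneg x) (Γ.hasSum_P x).summable
    rw [(Γ.hasSum_P x).tsum_eq, ENNReal.ofReal_one] at h
    rw [h]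
    exact ENNReal.summable.hasSum⟩

/-- The Markov kernel that moves the walk from its position `X_n` to `X_{n+1}`. -/
noncomputable def stepKernel {V : Type*} [Nontrivial V] [MeasurableSpace V]
    [DiscreteMeasurableSpace V] (Γ : WeightedGraph V) (n : ℕ) :
    Kernel (∀ _ : Finset.Iic n, V) V where
  toFun h := (Γ.stepPMF (h ⟨n, Finset.mem_Iic.2 le_rfl⟩)).toMeasure
  measurable' := (Measurable.of_discrete (f := fun x : V => (Γ.stepPMF x).toMeasure)).comp
    (measurable_pi_apply _)

instance {V : Type*} [Nontrivial V] [MeasurableSpace V] [DiscreteMeasurableSpace V]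
    (Γ : WeightedGraph V) (n : ℕ) : IsMarkovKernel (Γ.stepKernel n) :=
  ⟨fun _ => PMF.toMeasure.isProbabilityMeasure _⟩

/-- The law on the space of paths `ℕ → V` of the random walk `X_0, X_1, …` with transition
probabilities `P` started at `X_0 = z`. -/
noncomputable def walkLaw {V : Type*} [Nontrivial V] [MeasurableSpace V]
    [DiscreteMeasurableSpace V] (Γ : WeightedGraph V) (z : V) : Measure (ℕ → V) :=
  Kernel.trajMeasure (X := fun _ => V) (Measure.dirac z) Γ.stepKernel

/-- The exit time `T_A = min {k : X_k ∉ A}` of a path, `∞` if the path stays in `A`. -/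
noncomputable def exitTime {V : Type*} (A : Set V) (ω : ℕ → V) : ℕ∞ :=
  ⨅ (k : ℕ) (_ : ω k ∉ A), (k : ℕ∞)

/-- `E_z(A)`, the expectation of `T_A` for the walk started at `z`. -/
noncomputable def meanExit {V : Type*} [Nontrivial V] [MeasurableSpace V]
    [DiscreteMeasurableSpace V] (Γ : WeightedGraph V) (z : V) (A : Set V) : ℝ≥0∞ :=
  ∫⁻ ω, (exitTime A ω : ℝ≥0∞) ∂(Γ.walkLaw z)

/-- The open ball `B(x,R)` of the graph distance. -/
def ball {V : Type*} (Γ : WeightedGraph V) (x : V) (R : ℝ) : Set V :=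
  {y | (Γ.graph.dist x y : ℝ) < R}

/-- `V(x,R) = μ(B(x,R))`. -/
noncomputable def vol {V : Type*} (Γ : WeightedGraph V) (x : V) (R : ℝ) : ℝ≥0∞ :=
  ∑' y : Γ.ball x R, ENNReal.ofReal (Γ.mass y)

/-- `E(x,R)`, the mean exit time from `B(x,R)` for the walk started at the centre. -/
noncomputable def E {V : Type*} [Nontrivial V] [MeasurableSpace V]
    [DiscreteMeasurableSpace V] (Γ : WeightedGraph V) (x : V) (R : ℝ) : ℝ≥0∞ :=
  Γ.meanExit x (Γ.ball x R)

/-- `F(R) = inf_x E(x,R)`. -/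
noncomputable def F {V : Type*} [Nontrivial V] [MeasurableSpace V]
    [DiscreteMeasurableSpace V] (Γ : WeightedGraph V) (R : ℝ) : ℝ≥0∞ :=
  ⨅ x, Γ.E x R

/-- Condition `(p₀)`. -/
def ControlledWeights {V : Type*} (Γ : WeightedGraph V) : Prop :=
  ∃ p₀ : ℝ, 0 < p₀ ∧ ∀ x y, Γ.Adj x y → p₀ ≤ Γ.P x y

/-- Volume doubling `(VD)`. -/
def VolumeDoubling {V : Type*} (Γ : WeightedGraph V) : Prop :=
  ∃ D : ℝ, 0 < D ∧ ∀ (x : V) (R : ℝ), 0 < R → Γ.vol x (2 * R) ≤ ENNReal.ofReal D * Γ.vol x R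

/-- Homogeneity of the mean exit time, `E(x,R) ≃ E(y,R)`, condition `(E)`. -/
def HomogeneousExit {V : Type*} [Nontrivial V] [MeasurableSpace V]
    [DiscreteMeasurableSpace V] (Γ : WeightedGraph V) : Prop :=
  ∃ C : ℝ, 1 < C ∧ ∀ (x y : V) (R : ℝ), 0 < R → Γ.E x R ≤ ENNReal.ofReal C * Γ.E y R

/-- A set together with all neighbours of its points. -/
def closure {V : Type*} (Γ : WeightedGraph V) (A : Set V) : Set V :=
  A ∪ {y | ∃ x ∈ A, Γ.Adj x y}

/-- `u` is harmonic on `A`: `∑_y P(x,y) u(y) = u(x)` for `x ∈ A`. Only the values of `u` on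
`Γ.closure A` matter. -/
def HarmonicOn {V : Type*} (Γ : WeightedGraph V) (u : V → ℝ) (A : Set V) : Prop :=
  ∀ x ∈ A, HasSum (fun y => Γ.P x y * u y) (u x)

/-- The elliptic Harnack inequality `(H)`. -/
def Harnack {V : Type*} (Γ : WeightedGraph V) : Prop :=
  ∃ H : ℝ, 1 < H ∧ ∀ (x : V) (R : ℝ), 0 < R → ∀ u : V → ℝ,
    (∀ y ∈ Γ.closure (Γ.ball x (2 * R)), 0 ≤ u y) → Γ.HarmonicOn u (Γ.ball x (2 * R)) →
      ∀ y ∈ Γ.ball x R, ∀ z ∈ Γ.ball x R, u y ≤ H * u z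

end WeightedGraph

/-!
From a vertex `z` with `d(x, z) = 2R`, the walk needs a mean time of at least `F(R)` to leave
`B(z, R)`. It then reaches distance `R` from `x` before leaving `B(x, 3R)` with a probability
bounded from below, and once it is there it still needs at least `2F(R)` to leave `B(x, 3R)`.
Since the walk started at `x` takes at least `2F(R)` to get to distance `2R`, altogether
`E(x, 3R) ≥ (3 + c) F(R)`.

The hitting probability is bounded below by a ratio of values of the Green function `g(x, ·)` of
`B(x, 3R)` at distances `2R` and `R` from `x`, which the Harnack inequality controls along a chain
of balls. When the chain has to come close to `y`, where `d(x, y) = R`, it branches off there.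
Otherwise the symmetry of `g` allows one to move the pole: `g(y, ·)` is compared along a geodesic
from `x` to `z`, and `g(z, ·)` along one from `y` to `x`, and neither chain meets its pole.
-/

namespace WeightedGraph

section Walk

/-- The transition operator `φ ↦ P φ` on functions with values in `[0, ∞]`. -/
noncomputable def transition {V : Type*} (Γ : WeightedGraph V) (φ : V → ℝ≥0∞) (x : V) : ℝ≥0∞ :=
  ∑' y, ENNReal.ofReal (Γ.P x y) * φ y

/-- The event that the path stays in `A` up to and including time `n`. -/
def staysIn {V : Type*} (A : Set V) (n : ℕ) : Set (ℕ → V) := {ω | ∀ k ≤ n, ω k ∈ A}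

theorem staysIn_eq_preimage {V : Type*} (A : Set V) (n : ℕ) :
    staysIn A n = Preorder.frestrictLe n ⁻¹' Set.univ.pi fun _ => A := by
  ext ω
  simp [staysIn]

theorem staysIn_succ {V : Type*} (A : Set V) (n : ℕ) :
    staysIn A (n + 1) = (fun ω => ω (n + 1)) ⁻¹' A ∩ staysIn A n := by
  ext ω
  simp only [staysIn, Set.mem_ofPred_eq, Set.mem_inter_iff, Set.mem_preimage,
    Nat.le_succ_iff, or_imp, forall_and, forall_eq, and_comm, Nat.succ_eq_add_one]

theorem measurableSet_staysIn {V : Type*} [MeasurableSpace V] [DiscreteMeasurableSpace V]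
    (A : Set V) (n : ℕ) : MeasurableSet (staysIn A n) := by
  rw [staysIn_eq_preimage]
  exact (by fun_prop : Measurable (Preorder.frestrictLe (π := fun _ : ℕ => V) n))
    (MeasurableSet.univ_pi fun _ => MeasurableSet.of_discrete)

theorem exitTime_eq_tsum_indicator {V : Type*} (A : Set V) (ω : ℕ → V) :
    (exitTime A ω : ℝ≥0∞) = ∑' n, (staysIn A n).indicator 1 ω := by
  classical
  simp only [Set.indicator_apply, staysIn, Set.mem_ofPred_eq, Pi.one_apply]
  by_cases h : ∃ k, ω k ∉ A
  · have exitTime_eq_find : exitTime A ω = (Nat.find h : ℕ∞) := by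
      refine le_antisymm (iInf₂_le (Nat.find h) (Nat.find_spec h)) (le_iInf₂ fun k hk => ?_)
      exact_mod_cast Nat.find_min' h hk
    have stays_iff : ∀ n, (∀ k ≤ n, ω k ∈ A) ↔ n ∈ Finset.range (Nat.find h) := fun n => by
      simp [Nat.lt_find_iff]
    simp only [stays_iff]
    rw [tsum_eq_sum (s := Finset.range (Nat.find h)) fun n hn => if_neg hn, exitTime_eq_find,
      Finset.sum_ite_mem]
    simp
  · push Not at h
    simp [exitTime, h]

theorem exitTime_mono {V : Type*} {A B : Set V} (h : A ⊆ B) (ω : ℕ → V) :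
    exitTime A ω ≤ exitTime B ω :=
  le_iInf₂ fun k hk => iInf₂_le k fun hA => hk (h hA)

variable {V : Type*} [Nontrivial V] [MeasurableSpace V] [DiscreteMeasurableSpace V]
  (Γ : WeightedGraph V)

theorem lintegral_stepPMF [Countable V] (x : V) (φ : V → ℝ≥0∞) :
    ∫⁻ y, φ y ∂(Γ.stepPMF x).toMeasure = Γ.transition φ x := by
  rw [lintegral_countable']
  refine tsum_congr fun y => ?_
  rw [PMF.toMeasure_apply_singleton _ _ (measurableSet_singleton y), mul_comm]
  rfl

theorem map_eval_zero_walkLaw (z : V) :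
    (Γ.walkLaw z).map (fun ω => ω 0) = Measure.dirac z := by
  have eval_zero_eq : (fun ω : ℕ → V => ω 0) =
      (MeasurableEquiv.piUnique fun _ : Finset.Iic 0 => V) ∘ Preorder.frestrictLe 0 := rfl
  rw [eval_zero_eq, ← Measure.map_map (by fun_prop) (by fun_prop), walkLaw, Kernel.trajMeasure,
    Measure.map_comp _ _ (by fun_prop), Kernel.traj_map_frestrictLe, Kernel.partialTraj_self,
    Measure.id_comp, Measure.map_map (by fun_prop) (by fun_prop)]
  simp

theorem lintegral_walkLaw_zero (z : V) (φ : V → ℝ≥0∞) :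
    ∫⁻ ω, φ (ω 0) ∂Γ.walkLaw z = φ z := by
  rw [← lintegral_dirac z φ, ← map_eval_zero_walkLaw,
    lintegral_map Measurable.of_discrete (by fun_prop)]

theorem setLIntegral_walkLaw_succ [Countable V] (z : V) (n : ℕ)
    {S : Set (∀ _ : Finset.Iic n, V)} (hS : MeasurableSet S) (φ : V → ℝ≥0∞) :
    ∫⁻ ω in Preorder.frestrictLe n ⁻¹' S, φ (ω (n + 1)) ∂Γ.walkLaw z =
      ∫⁻ ω in Preorder.frestrictLe n ⁻¹' S, Γ.transition φ (ω n) ∂Γ.walkLaw z := by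
  have hφ : Measurable φ := .of_discrete
  have hPφ : Measurable (Γ.transition φ) := .of_discrete
  have joint_law := Kernel.map_frestrictLe_trajMeasure_compProd_eq_map_trajMeasure
    (X := fun _ => V) (μ₀ := Measure.dirac z) (κ := Γ.stepKernel) (a := n)
  have step (h : ∀ _ : Finset.Iic n, V) :
      ∫⁻ y, φ y ∂Γ.stepKernel n h = Γ.transition φ (h ⟨n, Finset.mem_Iic.2 le_rfl⟩) :=
    Γ.lintegral_stepPMF _ φ
  calc ∫⁻ ω in Preorder.frestrictLe n ⁻¹' S, φ (ω (n + 1)) ∂Γ.walkLaw z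
      = ∫⁻ q in S ×ˢ Set.univ, φ q.2
          ∂(Γ.walkLaw z).map fun ω => (Preorder.frestrictLe n ω, ω (n + 1)) := by
        rw [setLIntegral_map (hS.prod .univ) (by fun_prop) (by fun_prop), Set.mk_preimage_prod,
          Set.preimage_univ, Set.inter_univ]
    _ = ∫⁻ h in S, ∫⁻ y, φ y ∂Γ.stepKernel n h
          ∂(Γ.walkLaw z).map (Preorder.frestrictLe n) := by
        rw [walkLaw, ← joint_law, Measure.setLIntegral_compProd (by fun_prop) hS .univ]
        simp only [Measure.restrict_univ]
    _ = ∫⁻ ω in Preorder.frestrictLe n ⁻¹' S, Γ.transition φ (ω n) ∂Γ.walkLaw z := by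
        simp only [step]
        rw [setLIntegral_map hS (by fun_prop) (by fun_prop)]
        rfl

/-- The killed semigroup `E_z(φ(X_n); n < T_A)` of the walk stopped on leaving `A`. -/
noncomputable def killed (A : Set V) (n : ℕ) (φ : V → ℝ≥0∞) (z : V) : ℝ≥0∞ :=
  ∫⁻ ω in staysIn A n, φ (ω n) ∂Γ.walkLaw z

theorem killed_zero (A : Set V) (φ : V → ℝ≥0∞) : Γ.killed A 0 φ = A.indicator φ := by
  ext z
  rw [← Γ.lintegral_walkLaw_zero z (A.indicator φ), killed,
    ← lintegral_indicator (measurableSet_staysIn A 0)]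
  refine lintegral_congr fun ω => ?_
  simp only [staysIn, nonpos_iff_eq_zero, forall_eq]
  rfl

theorem killed_succ [Countable V] (A : Set V) (n : ℕ) (φ : V → ℝ≥0∞) :
    Γ.killed A (n + 1) φ = Γ.killed A n (Γ.transition (A.indicator φ)) := by
  ext z
  have hA : MeasurableSet ((fun ω : ℕ → V => ω (n + 1)) ⁻¹' A) :=
    measurable_pi_apply (n + 1) .of_discrete
  rw [killed, staysIn_succ, ← setLIntegral_indicator hA, killed, staysIn_eq_preimage,
    ← Γ.setLIntegral_walkLaw_succ z n (.univ_pi fun _ => .of_discrete) (A.indicator φ)]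
  rfl

theorem killed_succ_eq_indicator [Countable V] (A : Set V) (n : ℕ) (φ : V → ℝ≥0∞) :
    Γ.killed A (n + 1) φ = A.indicator (Γ.transition (Γ.killed A n φ)) := by
  induction n generalizing φ with
  | zero => rw [killed_succ, killed_zero, killed_zero]
  | succ n ih => rw [killed_succ, ih, ← killed_succ]

theorem meanExit_eq_tsum_killed (A : Set V) (z : V) :
    Γ.meanExit z A = ∑' n, Γ.killed A n 1 z := by
  simp only [meanExit, exitTime_eq_tsum_indicator]
  rw [lintegral_tsum fun n => (measurable_one.indicator (measurableSet_staysIn A n)).aemeasurable]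
  exact tsum_congr fun n => lintegral_indicator (measurableSet_staysIn A n) 1

theorem meanExit_eq_indicator [Countable V] (A : Set V) (z : V) :
    Γ.meanExit z A = A.indicator (fun z => 1 + Γ.transition (fun y => Γ.meanExit y A) z) z := by
  rw [meanExit_eq_tsum_killed, tsum_eq_zero_add' ENNReal.summable]
  simp only [killed_zero, killed_succ_eq_indicator]
  by_cases hz : z ∈ A
  · simp only [Set.indicator_of_mem hz, transition, meanExit_eq_tsum_killed, Pi.one_apply]
    rw [ENNReal.tsum_comm]
    simp only [ENNReal.tsum_mul_left]
  · simp [Set.indicator_of_notMem hz]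

theorem meanExit_of_notMem [Countable V] {A : Set V} {z : V} (hz : z ∉ A) :
    Γ.meanExit z A = 0 := by
  rw [meanExit_eq_indicator, Set.indicator_of_notMem hz]

theorem meanExit_of_mem [Countable V] {A : Set V} {z : V} (hz : z ∈ A) :
    Γ.meanExit z A = 1 + Γ.transition (fun y => Γ.meanExit y A) z := by
  rw [meanExit_eq_indicator, Set.indicator_of_mem hz]

/-- A super-solution dominates every partial sum of `∑ₙ P_z(n < T_A)`, by induction on its
length. -/
theorem meanExit_le_of_superSolution [Countable V] {A : Set V} {w : V → ℝ≥0∞}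
    (hw : ∀ z ∈ A, 1 + Γ.transition w z ≤ w z) (z : V) : Γ.meanExit z A ≤ w z := by
  have sum_killed_le : ∀ n z, ∑ k ∈ Finset.range n, Γ.killed A k 1 z ≤ w z := by
    intro n
    induction n with
    | zero => simp
    | succ n ih =>
      intro z
      rw [Finset.sum_range_succ']
      simp only [killed_zero, killed_succ_eq_indicator]
      by_cases hz : z ∈ A
      · simp only [Set.indicator_of_mem hz, Pi.one_apply]
        calc ∑ k ∈ Finset.range n, Γ.transition (Γ.killed A k 1) z + 1
            = 1 + Γ.transition (fun y => ∑ k ∈ Finset.range n, Γ.killed A k 1 y) z := by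
              simp only [transition, Finset.mul_sum]
              rw [add_comm, Summable.tsum_finsetSum fun _ _ => ENNReal.summable]
          _ ≤ 1 + Γ.transition w z := by
              unfold transition
              gcongr
              exact ih _
          _ ≤ w z := hw z hz
      · simp [Set.indicator_of_notMem hz]
  rw [meanExit_eq_tsum_killed, ENNReal.tsum_eq_iSup_nat]
  exact iSup_le fun n => sum_killed_le n z

theorem meanExit_mono (z : V) {A B : Set V} (h : A ⊆ B) : Γ.meanExit z A ≤ Γ.meanExit z B :=
  lintegral_mono fun ω => ENat.toENNReal_mono (exitTime_mono h ω)

theorem meanExit_univ (z : V) : Γ.meanExit z Set.univ = ⊤ := by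
  have : IsProbabilityMeasure (Γ.walkLaw z) := by unfold walkLaw; infer_instance
  simp [meanExit, exitTime]

end Walk

section Distance

variable {V : Type*} (Γ : WeightedGraph V)

theorem adj_comm {x y : V} : Γ.Adj x y ↔ Γ.Adj y x := by
  rw [Adj, Adj, Γ.symm]

theorem adj_of_graph_adj {x y : V} (h : Γ.graph.Adj x y) : Γ.Adj x y := by
  rcases ((SimpleGraph.fromRel_adj _ _ _).1 h).2 with h | h
  · exact h
  · exact Γ.adj_comm.1 h

theorem adj_of_dist_eq_one {x y : V} (h : Γ.graph.dist x y = 1) : Γ.Adj x y :=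
  Γ.adj_of_graph_adj (SimpleGraph.dist_eq_one_iff_adj.1 h)

theorem dist_le_one_of_adj {x y : V} (h : Γ.Adj x y) : Γ.graph.dist x y ≤ 1 := by
  rcases eq_or_ne x y with rfl | hxy
  · simp
  · exact (SimpleGraph.dist_eq_one_iff_adj.2
      ((SimpleGraph.fromRel_adj _ _ _).2 ⟨hxy, Or.inl h⟩)).le

theorem dist_triangle (x y z : V) : Γ.graph.dist x z ≤ Γ.graph.dist x y + Γ.graph.dist y z :=
  Γ.connected.dist_triangle

theorem dist_comm (x y : V) : Γ.graph.dist x y = Γ.graph.dist y x := SimpleGraph.dist_comm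

theorem eq_of_dist_eq_zero {x y : V} (h : Γ.graph.dist x y = 0) : x = y :=
  Γ.connected.dist_eq_zero_iff.1 h

theorem exists_dist_eq {a b : V} {k : ℕ} (h : k ≤ Γ.graph.dist a b) :
    ∃ c, Γ.graph.dist a c = k ∧ Γ.graph.dist c b = Γ.graph.dist a b - k := by
  obtain ⟨w, hw⟩ : ∃ w : Γ.graph.Walk a b, w.length = Γ.graph.dist a b :=
    Γ.connected.exists_walk_length_eq_dist a b
  have dist_left : Γ.graph.dist a (w.getVert k) ≤ k :=
    (SimpleGraph.dist_le (w.take k)).trans (by rw [SimpleGraph.Walk.take_length]; omega)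
  have dist_right : Γ.graph.dist (w.getVert k) b ≤ Γ.graph.dist a b - k :=
    (SimpleGraph.dist_le (w.drop k)).trans (by rw [SimpleGraph.Walk.drop_length]; omega)
  have triangle := Γ.dist_triangle a (w.getVert k) b
  exact ⟨w.getVert k, by omega, by omega⟩

theorem eq_univ_of_adj_closed {S : Set V} (hne : S.Nonempty)
    (hS : ∀ a ∈ S, ∀ b, Γ.Adj a b → b ∈ S) : S = Set.univ := by
  obtain ⟨a, ha⟩ := hne
  refine Set.eq_univ_of_forall fun b => ?_
  obtain ⟨w⟩ := Γ.connected.preconnected a b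
  induction w with
  | nil => exact ha
  | cons hadj _ ih => exact ih (hS _ ha _ (Γ.adj_of_graph_adj hadj))

theorem mem_ball {x y : V} {R : ℝ} : y ∈ Γ.ball x R ↔ (Γ.graph.dist x y : ℝ) < R := Iff.rfl

theorem mem_ball_natCast {x y : V} {R : ℕ} : y ∈ Γ.ball x R ↔ Γ.graph.dist x y < R := by
  rw [mem_ball, Nat.cast_lt]

theorem mem_ball_three_mul {x y : V} {R : ℕ} (hR : 1 ≤ R) (h : Γ.graph.dist x y ≤ 2 * R) :
    y ∈ Γ.ball x (3 * R) := by
  rw [mem_ball]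
  exact_mod_cast (by omega : Γ.graph.dist x y < 3 * R)

theorem ball_mono {R S : ℝ} (x : V) (h : R ≤ S) : Γ.ball x R ⊆ Γ.ball x S :=
  fun _ hy => lt_of_lt_of_le hy h

theorem ball_subset_ball {x y : V} {R S : ℝ} (h : Γ.graph.dist x y + R ≤ S) :
    Γ.ball y R ⊆ Γ.ball x S := by
  intro z hz
  have triangle : (Γ.graph.dist x z : ℝ) ≤ Γ.graph.dist x y + Γ.graph.dist y z := by
    exact_mod_cast Γ.dist_triangle x y z
  rw [mem_ball] at hz ⊢
  linarith

theorem dist_eq_of_adj_ball {x y z : V} {R : ℕ} (hy : y ∈ Γ.ball x R) (hz : z ∉ Γ.ball x R)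
    (h : Γ.Adj y z) : Γ.graph.dist x z = R := by
  have step := Γ.dist_le_one_of_adj h
  have triangle := Γ.dist_triangle x y z
  rw [mem_ball_natCast] at hy hz
  omega

/-- The vertices lying on some geodesic from `a` to `b`. -/
def geodesicInterval (a b : V) : Set V :=
  {p | Γ.graph.dist a p + Γ.graph.dist p b = Γ.graph.dist a b}

theorem left_mem_geodesicInterval (a b : V) : a ∈ Γ.geodesicInterval a b := by
  simp [geodesicInterval]

theorem geodesicInterval_subset_right {a b c : V} (hc : c ∈ Γ.geodesicInterval a b) :
    Γ.geodesicInterval c b ⊆ Γ.geodesicInterval a b := by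
  intro p hp
  have triangle_acp := Γ.dist_triangle a c p
  have triangle_apb := Γ.dist_triangle a p b
  simp only [geodesicInterval, Set.mem_ofPred_eq] at hc hp ⊢
  omega

/-- Every vertex has finitely many neighbours. -/
def IsLocallyFinite : Prop := ∀ x, {y | Γ.Adj x y}.Finite

variable {Γ}

theorem IsLocallyFinite.finite_ball (hΓ : Γ.IsLocallyFinite) (x : V) (R : ℝ) :
    (Γ.ball x R).Finite := by
  have finite_closedBall : ∀ n : ℕ, {y | Γ.graph.dist x y ≤ n}.Finite := by
    intro n
    induction n with
    | zero =>
      refine (Set.finite_singleton x).subset fun y hy => ?_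
      exact (Γ.eq_of_dist_eq_zero (Nat.le_zero.1 hy)).symm
    | succ n ih =>
      refine (ih.union (ih.biUnion fun c _ => hΓ c)).subset fun y (hy : _ ≤ n + 1) => ?_
      rcases Nat.lt_or_ge n (Γ.graph.dist x y) with hn | hn
      · obtain ⟨c, hxc, hcy⟩ := Γ.exists_dist_eq hn.le
        exact Or.inr (Set.mem_biUnion (x := c) hxc.le (Γ.adj_of_dist_eq_one (by omega)))
      · exact Or.inl hn
  refine (finite_closedBall ⌈R⌉₊).subset fun y (hy : (Γ.graph.dist x y : ℝ) < R) => ?_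
  exact_mod_cast hy.le.trans (Nat.le_ceil R)

theorem P_eq_zero {x y : V} (h : ¬ Γ.Adj x y) : Γ.P x y = 0 := by
  rw [P, le_antisymm (not_lt.1 h) (Γ.nonneg x y), zero_div]

theorem P_pos [Nontrivial V] {x y : V} (h : Γ.Adj x y) : 0 < Γ.P x y :=
  div_pos h (Γ.mass_pos x)

theorem ControlledWeights.isLocallyFinite [Nontrivial V] (hp : Γ.ControlledWeights) :
    Γ.IsLocallyFinite := by
  intro x
  obtain ⟨p₀, hp₀, hP⟩ := hp
  have eventually_lt := (Γ.hasSum_P x).summable.tendsto_cofinite_zero.eventually (gt_mem_nhds hp₀)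
  rw [Filter.eventually_cofinite] at eventually_lt
  exact eventually_lt.subset fun y hy => not_lt.2 (hP x y hy)

end Distance

section Potential

variable {V : Type*} {Γ : WeightedGraph V}

/-- The probabilistic Laplacian `I - P`. -/
noncomputable def laplacian (Γ : WeightedGraph V) (f : V → ℝ) (x : V) : ℝ :=
  f x - ∑' y, Γ.P x y * f y

theorem hasSum_P_mul (hΓ : Γ.IsLocallyFinite) (f : V → ℝ) (x : V) :
    HasSum (fun y => Γ.P x y * f y) (f x - Γ.laplacian f x) := by
  rw [laplacian, sub_sub_cancel]
  refine (summable_of_hasFiniteSupport ((hΓ x).subset fun y hy => ?_)).hasSum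
  by_contra hxy
  exact hy (by simp [P_eq_zero hxy])

theorem laplacian_eq_of_hasSum {f : V → ℝ} {x : V} {s : ℝ}
    (h : HasSum (fun y => Γ.P x y * f y) s) : Γ.laplacian f x = f x - s := by
  rw [laplacian, h.tsum_eq]

theorem harmonicOn_iff (hΓ : Γ.IsLocallyFinite) {f : V → ℝ} {A : Set V} :
    Γ.HarmonicOn f A ↔ ∀ x ∈ A, Γ.laplacian f x = 0 := by
  refine forall₂_congr fun x _ => ⟨fun h => ?_, fun h => ?_⟩
  · rw [laplacian_eq_of_hasSum h, sub_self]
  · simpa [h] using hasSum_P_mul hΓ f x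

theorem laplacian_add (hΓ : Γ.IsLocallyFinite) (f g : V → ℝ) (x : V) :
    Γ.laplacian (f + g) x = Γ.laplacian f x + Γ.laplacian g x := by
  have h : HasSum (fun y => Γ.P x y * (f + g) y)
      ((f x - Γ.laplacian f x) + (g x - Γ.laplacian g x)) := by
    simpa only [Pi.add_apply, mul_add] using (hasSum_P_mul hΓ f x).add (hasSum_P_mul hΓ g x)
  rw [laplacian_eq_of_hasSum h, Pi.add_apply]
  ring

theorem laplacian_smul (c : ℝ) (f : V → ℝ) (x : V) :
    Γ.laplacian (c • f) x = c * Γ.laplacian f x := by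
  simp only [laplacian, Pi.smul_apply, smul_eq_mul, mul_left_comm _ c, tsum_mul_left, mul_sub]

theorem laplacian_sub (hΓ : Γ.IsLocallyFinite) (f g : V → ℝ) (x : V) :
    Γ.laplacian (f - g) x = Γ.laplacian f x - Γ.laplacian g x := by
  rw [sub_eq_add_neg, ← neg_one_smul ℝ g, laplacian_add hΓ, laplacian_smul]
  ring

theorem laplacian_const [Nontrivial V] (c : ℝ) (x : V) : Γ.laplacian (fun _ => c) x = 0 := by
  rw [laplacian_eq_of_hasSum ((Γ.hasSum_P x).mul_right c), one_mul, sub_self]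

theorem P_mul_le_sub_laplacian (hΓ : Γ.IsLocallyFinite) {f : V → ℝ} {x : V}
    (hf : ∀ y, Γ.Adj x y → 0 ≤ f y) (y : V) : Γ.P x y * f y ≤ f x - Γ.laplacian f x := by
  refine le_hasSum (hasSum_P_mul hΓ f x) y fun z _ => ?_
  by_cases hxz : Γ.Adj x z
  · exact mul_nonneg (Γ.P_nonneg x z) (hf z hxz)
  · simp [P_eq_zero hxz]

theorem transition_ofReal (hΓ : Γ.IsLocallyFinite) {f : V → ℝ} (hf : ∀ x, 0 ≤ f x) (x : V) :
    Γ.transition (fun y => ENNReal.ofReal (f y)) x = ENNReal.ofReal (f x - Γ.laplacian f x) := by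
  have h := hasSum_P_mul hΓ f x
  rw [← h.tsum_eq, ENNReal.ofReal_tsum_of_nonneg
    (fun y => mul_nonneg (Γ.P_nonneg x y) (hf y)) h.summable]
  exact tsum_congr fun y => (ENNReal.ofReal_mul (Γ.P_nonneg x y)).symm

theorem mass_mul_laplacian [Nontrivial V] {f : V → ℝ} {U : Finset V} (hf : ∀ x ∉ U, f x = 0)
    (x : V) :
    Γ.mass x * Γ.laplacian f x = Γ.mass x * f x - ∑ y ∈ U, Γ.weight x y * f y := by
  rw [laplacian, tsum_eq_sum (s := U) fun y hy => by rw [hf y hy, mul_zero], mul_sub,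
    Finset.mul_sum]
  congr 1
  refine Finset.sum_congr rfl fun y _ => ?_
  rw [P, ← mul_assoc, mul_div_cancel₀ _ (Γ.mass_pos x).ne']

theorem sum_mass_mul_laplacian_mul_comm [Nontrivial V] {f h : V → ℝ} {U : Finset V}
    (hf : ∀ x ∉ U, f x = 0) (hh : ∀ x ∉ U, h x = 0) :
    ∑ x ∈ U, Γ.mass x * Γ.laplacian f x * h x = ∑ x ∈ U, Γ.mass x * Γ.laplacian h x * f x := by
  simp only [mass_mul_laplacian hf, mass_mul_laplacian hh, sub_mul, Finset.sum_sub_distrib,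
    Finset.sum_mul]
  rw [Finset.sum_comm (f := fun x y => Γ.weight x y * h y * f x)]
  congr 1
  · exact Finset.sum_congr rfl fun x _ => by ring
  · refine Finset.sum_congr rfl fun x _ => Finset.sum_congr rfl fun y _ => ?_
    rw [Γ.symm x y]
    ring

variable [Nontrivial V]

theorem eq_of_adj_of_isMinOn (hΓ : Γ.IsLocallyFinite) {f : V → ℝ} {a b : V}
    (hf : 0 ≤ Γ.laplacian f a) (hmin : ∀ y, Γ.Adj a y → f a ≤ f y) (hab : Γ.Adj a b) :
    f b = f a := by
  have h := P_mul_le_sub_laplacian hΓ (f := f - fun _ => f a) (x := a)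
    (fun y hy => sub_nonneg.2 (hmin y hy)) b
  rw [laplacian_sub hΓ, laplacian_const, Pi.sub_apply, Pi.sub_apply] at h
  have hP := P_pos hab
  exact le_antisymm (by nlinarith) (hmin b hab)

theorem nonneg_of_laplacian_nonneg (hΓ : Γ.IsLocallyFinite) {A : Set V} (hA : A.Finite)
    (hA_ne : A ≠ Set.univ) {f : V → ℝ} (hf : ∀ x ∈ A, 0 ≤ Γ.laplacian f x)
    (hf_bdry : ∀ x ∈ A, ∀ y ∉ A, Γ.Adj x y → 0 ≤ f y) : ∀ x ∈ A, 0 ≤ f x := by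
  by_contra! ⟨x, hx, hfx⟩
  obtain ⟨a, ha, ha_min⟩ := Set.exists_min_image A f hA ⟨x, hx⟩
  have hfa : f a < 0 := (ha_min x hx).trans_lt hfx
  have minimizers_eq_univ : {b ∈ A | f b = f a} = Set.univ := by
    refine Γ.eq_univ_of_adj_closed ⟨a, ha, rfl⟩ fun b ⟨hb, hba⟩ c hbc => ?_
    have hmin : ∀ y, Γ.Adj b y → f b ≤ f y := fun y hby => by
      by_cases hy : y ∈ A
      · exact hba.trans_le (ha_min y hy)
      · linarith [hf_bdry b hb y hy hby]
    have hca : f c = f a := (eq_of_adj_of_isMinOn hΓ (hf b hb) hmin hbc).trans hba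
    exact ⟨by_contra fun hc => by linarith [hf_bdry b hb c hc hbc], hca⟩
  exact hA_ne (Set.eq_univ_of_subset (Set.sep_subset A _) minimizers_eq_univ)

theorem le_of_laplacian_le (hΓ : Γ.IsLocallyFinite) {A : Set V} (hA : A.Finite)
    (hA_ne : A ≠ Set.univ) {f g : V → ℝ} (hfg : ∀ x ∈ A, Γ.laplacian f x ≤ Γ.laplacian g x)
    (hfg_bdry : ∀ x ∈ A, ∀ y ∉ A, Γ.Adj x y → f y ≤ g y) : ∀ x ∈ A, f x ≤ g x := by
  intro x hx
  refine sub_nonneg.1 (nonneg_of_laplacian_nonneg hΓ hA hA_ne (f := g - f) (fun y hy => ?_)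
    (fun y hy z hz hyz => sub_nonneg.2 (hfg_bdry y hy z hz hyz)) x hx)
  rw [laplacian_sub hΓ]
  exact sub_nonneg.2 (hfg y hy)

theorem exists_laplacian_eq (hΓ : Γ.IsLocallyFinite) {U : Set V} (hU : U.Finite)
    (hU_ne : U ≠ Set.univ) (φ : V → ℝ) :
    ∃ f : V → ℝ, (∀ x ∉ U, f x = 0) ∧ ∀ x ∈ U, Γ.laplacian f x = φ x := by
  have := hU.to_subtype
  let extend : (U → ℝ) →ₗ[ℝ] V → ℝ := Function.ExtendByZero.linearMap ℝ Subtype.val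
  have extend_apply (f : U → ℝ) (x : U) : extend f x = f x :=
    Subtype.val_injective.extend_apply f (0 : V → ℝ) x
  have extend_of_notMem (f : U → ℝ) {x : V} (hx : x ∉ U) : extend f x = 0 :=
    Function.extend_apply' f (0 : V → ℝ) x fun ⟨u, hu⟩ => hx (hu ▸ u.2)
  let dirichletLaplacian : (U → ℝ) →ₗ[ℝ] U → ℝ :=
    { toFun f x := Γ.laplacian (extend f) x
      map_add' f g := by ext x; rw [map_add, laplacian_add hΓ, Pi.add_apply]
      map_smul' c f := by ext x; rw [map_smul, laplacian_smul]; rfl }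
  have nonneg_of_eq_zero (f : U → ℝ) (hf : dirichletLaplacian f = 0) (x : U) : 0 ≤ f x := by
    rw [← extend_apply f]
    exact nonneg_of_laplacian_nonneg hΓ hU hU_ne (fun y hy => (congrFun hf ⟨y, hy⟩).ge)
      (fun _ _ y hy _ => (extend_of_notMem f hy).ge) x x.2
  have injective : Function.Injective dirichletLaplacian := by
    refine (injective_iff_map_eq_zero _).2 fun f hf => funext fun x => ?_
    exact le_antisymm (neg_nonneg.1 (nonneg_of_eq_zero (-f) (by rw [map_neg, hf, neg_zero]) x))
      (nonneg_of_eq_zero f hf x)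
  obtain ⟨f, hf⟩ := LinearMap.injective_iff_surjective.1 injective fun x => φ x
  exact ⟨extend f, fun x hx => extend_of_notMem f hx, fun x hx => congrFun hf ⟨x, hx⟩⟩

end Potential

section Green

variable {V : Type*} {Γ : WeightedGraph V}

/-- `g` is the Green function of the walk killed on leaving `U`: for a pole `b ∈ U`, the function
`g b` solves the Dirichlet problem on `U` whose right-hand side is the unit mass at `b`, with
respect to the vertex measure. The values `g b` for `b ∉ U` are irrelevant. -/
structure IsGreenFunction (Γ : WeightedGraph V) (U : Set V) (g : V → V → ℝ) : Prop where
  eq_zero_of_notMem : ∀ b ∈ U, ∀ a ∉ U, g b a = 0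
  laplacian_pole : ∀ b ∈ U, Γ.laplacian (g b) b = (Γ.mass b)⁻¹
  laplacian_of_ne : ∀ b ∈ U, ∀ a ∈ U, a ≠ b → Γ.laplacian (g b) a = 0

variable {U : Set V} {g : V → V → ℝ}

theorem IsGreenFunction.harmonicOn (hg : Γ.IsGreenFunction U g) (hΓ : Γ.IsLocallyFinite) {b : V}
    (hb : b ∈ U) {W : Set V} (hWU : W ⊆ U) (hbW : b ∉ W) : Γ.HarmonicOn (g b) W :=
  (harmonicOn_iff hΓ).2 fun a ha =>
    hg.laplacian_of_ne b hb a (hWU ha) fun hab => hbW (hab ▸ ha)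

variable [Nontrivial V]

theorem exists_isGreenFunction (hΓ : Γ.IsLocallyFinite) (hU : U.Finite) (hU_ne : U ≠ Set.univ) :
    ∃ g, Γ.IsGreenFunction U g := by
  classical
  choose g hg_zero hg using fun b =>
    exists_laplacian_eq hΓ hU hU_ne (Pi.single b (Γ.mass b)⁻¹)
  exact ⟨g, fun b _ => hg_zero b, fun b hb => by rw [hg b b hb, Pi.single_eq_same],
    fun b _ a ha hab => by rw [hg b a ha, Pi.single_eq_of_ne hab]⟩

namespace IsGreenFunction

theorem laplacian_nonneg (hg : Γ.IsGreenFunction U g) {b : V} (hb : b ∈ U) {a : V} (ha : a ∈ U) :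
    0 ≤ Γ.laplacian (g b) a := by
  rcases eq_or_ne a b with rfl | hab
  · rw [hg.laplacian_pole a ha]
    exact (inv_pos.2 (Γ.mass_pos a)).le
  · exact (hg.laplacian_of_ne b hb a ha hab).ge

theorem nonneg (hg : Γ.IsGreenFunction U g) (hΓ : Γ.IsLocallyFinite) (hU : U.Finite)
    (hU_ne : U ≠ Set.univ) {b : V} (hb : b ∈ U) (a : V) : 0 ≤ g b a := by
  by_cases ha : a ∈ U
  · exact nonneg_of_laplacian_nonneg hΓ hU hU_ne (fun x hx => hg.laplacian_nonneg hb hx)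
      (fun _ _ y hy _ => (hg.eq_zero_of_notMem b hb y hy).ge) a ha
  · exact (hg.eq_zero_of_notMem b hb a ha).ge

theorem symm (hg : Γ.IsGreenFunction U g) (hU : U.Finite) {a b : V} (ha : a ∈ U) (hb : b ∈ U) :
    g a b = g b a := by
  have sum_eq {a b : V} (ha : a ∈ U) :
      ∑ x ∈ hU.toFinset, Γ.mass x * Γ.laplacian (g a) x * g b x = g b a := by
    rw [Finset.sum_eq_single_of_mem a (hU.mem_toFinset.2 ha) fun x hx hxa => by
      rw [hg.laplacian_of_ne a ha x (hU.mem_toFinset.1 hx) hxa, mul_zero, zero_mul],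
      hg.laplacian_pole a ha, mul_inv_cancel₀ (Γ.mass_pos a).ne', one_mul]
  have eq_zero {b : V} (hb : b ∈ U) (x : V) (hx : x ∉ hU.toFinset) : g b x = 0 :=
    hg.eq_zero_of_notMem b hb x fun h => hx (hU.mem_toFinset.2 h)
  rw [← sum_eq ha, ← sum_eq hb, sum_mass_mul_laplacian_mul_comm (eq_zero ha) (eq_zero hb)]

theorem pos_of_mem_ball {x : V} {R : ℝ} (hg : Γ.IsGreenFunction (Γ.ball x R) g)
    (hΓ : Γ.IsLocallyFinite) (h_ne : Γ.ball x R ≠ Set.univ) {z : V} (hz : z ∈ Γ.ball x R) :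
    0 < g x z := by
  have hx : x ∈ Γ.ball x R := by
    rw [mem_ball] at hz ⊢
    simpa using (Nat.cast_nonneg _).trans_lt hz
  have g_nonneg := hg.nonneg hΓ (hΓ.finite_ball x R) h_ne hx
  have P_mul_le (a b : V) : Γ.P a b * g x b ≤ g x a - Γ.laplacian (g x) a :=
    P_mul_le_sub_laplacian hΓ (fun y _ => g_nonneg y) b
  induction hn : Γ.graph.dist x z generalizing z with
  | zero =>
    obtain rfl := Γ.eq_of_dist_eq_zero hn
    have h := P_mul_le x x
    rw [hg.laplacian_pole x hx] at h
    linarith [inv_pos.2 (Γ.mass_pos x), mul_nonneg (Γ.P_nonneg x x) (g_nonneg x)]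
  | succ n ih =>
    obtain ⟨c, hxc, hcz⟩ := Γ.exists_dist_eq (a := x) (b := z) (k := n) (by omega)
    have hc : c ∈ Γ.ball x R := by
      rw [mem_ball, hxc]
      rw [mem_ball, hn] at hz
      push_cast at hz
      linarith
    have hzc : Γ.Adj z c := Γ.adj_comm.1 (Γ.adj_of_dist_eq_one (by omega))
    linarith [mul_pos (P_pos hzc) (ih hc hxc), P_mul_le z c, hg.laplacian_nonneg hx hz]

end IsGreenFunction

end Green

section MeanExitReal

variable {V : Type*} [Nontrivial V] [MeasurableSpace V] [DiscreteMeasurableSpace V]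
  {Γ : WeightedGraph V}

/-- The mean exit time `E_z(A)` as a real-valued function of `z`; the junk value `0` stands for
an infinite mean exit time, which does not occur for finite `A ≠ V`. -/
noncomputable def meanExitReal (Γ : WeightedGraph V) (A : Set V) (z : V) : ℝ :=
  (Γ.meanExit z A).toReal

theorem meanExitReal_nonneg (A : Set V) (z : V) : 0 ≤ Γ.meanExitReal A z := ENNReal.toReal_nonneg

variable [Countable V]

theorem meanExit_ne_top (hΓ : Γ.IsLocallyFinite) {A : Set V} (hA : A.Finite)
    (hA_ne : A ≠ Set.univ) (z : V) : Γ.meanExit z A ≠ ⊤ := by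
  obtain ⟨f, hf_zero, hf⟩ := exists_laplacian_eq hΓ hA hA_ne fun _ => 1
  have hf_nonneg (x : V) : 0 ≤ f x := by
    by_cases hx : x ∈ A
    · exact nonneg_of_laplacian_nonneg hΓ hA hA_ne
        (fun y hy => (hf y hy).symm ▸ zero_le_one) (fun _ _ y hy _ => (hf_zero y hy).ge) x hx
    · exact (hf_zero x hx).ge
  refine ne_top_of_le_ne_top ENNReal.ofReal_ne_top (meanExit_le_of_superSolution Γ
    (w := fun y => ENNReal.ofReal (f y)) (fun x hx => ?_) z)
  have one_le : 1 ≤ f x := by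
    have P_sum_nonneg := (hasSum_P_mul hΓ f x).nonneg fun y =>
      mul_nonneg (Γ.P_nonneg x y) (hf_nonneg y)
    linarith [hf x hx]
  rw [transition_ofReal hΓ hf_nonneg, hf x hx, ← ENNReal.ofReal_one,
    ← ENNReal.ofReal_add zero_le_one (sub_nonneg.2 one_le), add_sub_cancel]

theorem ofReal_meanExitReal (hΓ : Γ.IsLocallyFinite) {A : Set V} (hA : A.Finite)
    (hA_ne : A ≠ Set.univ) (z : V) : ENNReal.ofReal (Γ.meanExitReal A z) = Γ.meanExit z A :=
  ENNReal.ofReal_toReal (meanExit_ne_top hΓ hA hA_ne z)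

theorem meanExitReal_of_notMem {A : Set V} {z : V} (hz : z ∉ A) : Γ.meanExitReal A z = 0 := by
  rw [meanExitReal, meanExit_of_notMem Γ hz, ENNReal.toReal_zero]

theorem laplacian_meanExitReal (hΓ : Γ.IsLocallyFinite) {A : Set V} (hA : A.Finite)
    (hA_ne : A ≠ Set.univ) {z : V} (hz : z ∈ A) : Γ.laplacian (Γ.meanExitReal A) z = 1 := by
  have h := congrArg ENNReal.toReal (Γ.meanExit_of_mem hz)
  have P_sum_nonneg := (hasSum_P_mul hΓ (Γ.meanExitReal A) z).nonneg fun y =>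
    mul_nonneg (Γ.P_nonneg z y) (meanExitReal_nonneg A y)
  simp only [← ofReal_meanExitReal hΓ hA hA_ne] at h
  rw [transition_ofReal hΓ (meanExitReal_nonneg A), ENNReal.toReal_ofReal (meanExitReal_nonneg A z),
    ENNReal.toReal_add ENNReal.one_ne_top ENNReal.ofReal_ne_top, ENNReal.toReal_one,
    ENNReal.toReal_ofReal P_sum_nonneg] at h
  linarith

/-- By the strong Markov property `E_z(B) = E_z(A) + E_z(E_{X_T}(B))` with `T = T_A`, and a
harmonic minorant `w` of the boundary values of the last term is a lower bound for it. -/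
theorem meanExitReal_add_le (hΓ : Γ.IsLocallyFinite) {A B : Set V} (hB : B.Finite)
    (hB_ne : B ≠ Set.univ) (hAB : A ⊆ B) {w : V → ℝ} (hw : Γ.HarmonicOn w A)
    (hw_bdry : ∀ x ∈ A, ∀ y ∉ A, Γ.Adj x y → w y ≤ Γ.meanExitReal B y) {z : V} (hz : z ∈ A) :
    Γ.meanExitReal A z + w z ≤ Γ.meanExitReal B z := by
  have hA : A.Finite := hB.subset hAB
  have hA_ne : A ≠ Set.univ := mt (Set.eq_univ_of_subset hAB) hB_ne
  refine le_of_laplacian_le hΓ hA hA_ne (f := Γ.meanExitReal A + w) (fun x hx => ?_)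
    (fun x hx y hy hxy => ?_) z hz
  · rw [laplacian_add hΓ, laplacian_meanExitReal hΓ hA hA_ne hx, (harmonicOn_iff hΓ).1 hw x hx,
      add_zero, laplacian_meanExitReal hΓ hB hB_ne (hAB hx)]
  · rw [Pi.add_apply, meanExitReal_of_notMem hy, zero_add]
    exact hw_bdry x hx y hy hxy

end MeanExitReal

section Harnack

variable {V : Type*} {Γ : WeightedGraph V}

theorem le_pow_mul_of_geodesicInterval {f : V → ℝ} {K : ℝ} (hK : 0 ≤ K) {a b : V} {s N : ℕ}
    (hf : ∀ p ∈ Γ.geodesicInterval a b, ∀ q ∈ Γ.geodesicInterval a b,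
      Γ.graph.dist p q ≤ s → f p ≤ K * f q)
    (hN : Γ.graph.dist a b ≤ N * s) : f a ≤ K ^ N * f b := by
  induction N generalizing a with
  | zero =>
    obtain rfl := Γ.eq_of_dist_eq_zero (by omega : Γ.graph.dist a b = 0)
    simp
  | succ N ih =>
    obtain ⟨c, hac, hcb⟩ := Γ.exists_dist_eq (min_le_right s (Γ.graph.dist a b))
    have hc : c ∈ Γ.geodesicInterval a b := by
      simp only [geodesicInterval, Set.mem_ofPred_eq]
      omega
    have subset := Γ.geodesicInterval_subset_right hc
    rw [Nat.succ_mul] at hN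
    calc f a ≤ K * f c := hf a (Γ.left_mem_geodesicInterval a b) c hc (by omega)
      _ ≤ K * (K ^ N * f b) := by
        gcongr
        exact ih (fun p hp q hq => hf p (subset hp) q (subset hq)) (by omega)
      _ = K ^ (N + 1) * f b := by ring

/-- A family `g b` of functions of one variable, indexed by their poles `b`, satisfies a Harnack
inequality with constant `C` along the geodesics from `a` to `a'` which stay at distance at most
`2R` from `x` and at least `R / 2` from the pole. -/
def GeodesicHarnack (Γ : WeightedGraph V) (x : V) (R : ℕ) (C : ℝ) (g : V → V → ℝ) : Prop :=
  ∀ b a a' : V, Γ.graph.dist x b ≤ 2 * R → Γ.graph.dist a a' ≤ 2 * R →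
    (∀ p ∈ Γ.geodesicInterval a a', Γ.graph.dist x p ≤ 2 * R ∧ R ≤ 2 * Γ.graph.dist p b) →
    g b a ≤ C * g b a'

theorem GeodesicHarnack.le_of_near {x y z p : V} {R : ℕ} {C : ℝ} {g : V → V → ℝ}
    (hC : 0 ≤ C) (h : Γ.GeodesicHarnack x R C g) (hy : Γ.graph.dist x y = R)
    (hz : Γ.graph.dist x z = 2 * R) (hp : p ∈ Γ.geodesicInterval x z)
    (hpy : 2 * Γ.graph.dist p y < R) : g x y ≤ C ^ 2 * g x z := by
  have dist_xx : Γ.graph.dist x x = 0 := SimpleGraph.dist_self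
  have dist_py := Γ.dist_comm p y
  have triangle_xpy := Γ.dist_triangle x p y
  simp only [geodesicInterval, Set.mem_ofPred_eq] at hp
  have y_to_p : g x y ≤ C * g x p := by
    refine h x y p (by omega) (by omega) fun q hq => ?_
    have triangle_xyq := Γ.dist_triangle x y q
    have triangle_xqy := Γ.dist_triangle x q y
    have dist_qx := Γ.dist_comm q x
    have dist_qy := Γ.dist_comm q y
    simp only [geodesicInterval, Set.mem_ofPred_eq] at hq
    omega
  have p_to_z : g x p ≤ C * g x z := by
    refine h x p z (by omega) (by omega) fun q hq => ?_
    have triangle_xpq := Γ.dist_triangle x p q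
    have triangle_xqz := Γ.dist_triangle x q z
    have dist_qx := Γ.dist_comm q x
    simp only [geodesicInterval, Set.mem_ofPred_eq] at hq
    omega
  calc g x y ≤ C * g x p := y_to_p
    _ ≤ C * (C * g x z) := by gcongr
    _ = C ^ 2 * g x z := by ring

theorem GeodesicHarnack.le_of_far {x y z : V} {R : ℕ} {C : ℝ} {g : V → V → ℝ}
    (hC : 0 ≤ C) (h : Γ.GeodesicHarnack x R C g) (hxy : g x y = g y x) (hyz : g y z = g z y)
    (hzx : g z x = g x z) (hy : Γ.graph.dist x y = R) (hz : Γ.graph.dist x z = 2 * R)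
    (far : ∀ p ∈ Γ.geodesicInterval x z, R ≤ 2 * Γ.graph.dist p y) :
    g x y ≤ C ^ 2 * g x z := by
  have dist_yx : Γ.graph.dist y x = R := (Γ.dist_comm y x).trans hy
  have x_to_z : g y x ≤ C * g y z := by
    refine h y x z (by omega) (by omega) fun p hp => ⟨?_, far p hp⟩
    simp only [geodesicInterval, Set.mem_ofPred_eq] at hp
    omega
  have y_to_x : g z y ≤ C * g z x := by
    refine h z y x (by omega) (by omega) fun p hp => ?_
    have triangle := Γ.dist_triangle x p z
    have dist_px := Γ.dist_comm p x
    simp only [geodesicInterval, Set.mem_ofPred_eq] at hp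
    omega
  calc g x y = g y x := hxy
    _ ≤ C * g y z := x_to_z
    _ = C * g z y := by rw [hyz]
    _ ≤ C * (C * g z x) := by gcongr
    _ = C ^ 2 * g x z := by rw [hzx]; ring

variable [Nontrivial V]

theorem exists_harnack_of_dist_le_one_or_lt (hp : Γ.ControlledWeights) (hH : Γ.Harnack) :
    ∃ K : ℝ, 1 ≤ K ∧ ∀ ρ : ℝ, 0 < ρ → ∀ (f : V → ℝ) (a b : V), (∀ y, 0 ≤ f y) →
      Γ.HarmonicOn f (Γ.ball a (2 * ρ)) → Γ.HarmonicOn f (Γ.ball b (2 * ρ)) →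
      (Γ.graph.dist a b ≤ 1 ∨ (Γ.graph.dist a b : ℝ) < ρ) → f a ≤ K * f b := by
  have hΓ := hp.isLocallyFinite
  obtain ⟨p₀, hp₀, hP⟩ := hp
  obtain ⟨H, hH1, hH⟩ := hH
  refine ⟨max H p₀⁻¹, le_max_of_le_left hH1.le, fun ρ hρ f a b hf ha hb hab => ?_⟩
  have mem_ball_self {c : V} {r : ℝ} (hr : 0 < r) : c ∈ Γ.ball c r := by simpa [mem_ball]
  rcases hab with hab | hab
  · rcases Nat.le_one_iff_eq_zero_or_eq_one.1 hab with hab | hab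
    · obtain rfl := Γ.eq_of_dist_eq_zero hab
      exact le_mul_of_one_le_left (hf a) (le_max_of_le_left hH1.le)
    · have hba : Γ.Adj b a := Γ.adj_comm.1 (Γ.adj_of_dist_eq_one hab)
      have p₀_mul_le : p₀ * f a ≤ f b := calc
        p₀ * f a ≤ Γ.P b a * f a := mul_le_mul_of_nonneg_right (hP b a hba) (hf a)
        _ ≤ f b - Γ.laplacian f b := P_mul_le_sub_laplacian hΓ (fun y _ => hf y) a
        _ = f b := by
          rw [(harmonicOn_iff hΓ).1 hb b (mem_ball_self (by positivity)), sub_zero]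
      calc f a ≤ p₀⁻¹ * f b := by rwa [← div_eq_inv_mul, le_div_iff₀' hp₀]
        _ ≤ max H p₀⁻¹ * f b := mul_le_mul_of_nonneg_right (le_max_right _ _) (hf b)
  · calc f a ≤ H * f b := hH a ρ hρ f (fun y _ => hf y) ha a (mem_ball_self hρ) b hab
      _ ≤ max H p₀⁻¹ * f b := mul_le_mul_of_nonneg_right (le_max_left _ _) (hf b)

theorem exists_geodesicHarnack (hp : Γ.ControlledWeights) (hH : Γ.Harnack) :
    ∃ C : ℝ, 0 < C ∧ ∀ (x : V) (R : ℕ), 1 ≤ R → Γ.ball x (3 * R) ≠ Set.univ →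
      ∀ g, Γ.IsGreenFunction (Γ.ball x (3 * R)) g → Γ.GeodesicHarnack x R C g := by
  have hΓ := hp.isLocallyFinite
  obtain ⟨K, hK, harnack⟩ := exists_harnack_of_dist_le_one_or_lt hp hH
  refine ⟨K ^ 16, by positivity, fun x R hR h_ne g hg b a a' hxb haa' hab => ?_⟩
  have hR0 : (0 : ℝ) < R := by exact_mod_cast hR
  have hb : b ∈ Γ.ball x (3 * R) := Γ.mem_ball_three_mul hR hxb
  have harmonic {p : V} (hp : p ∈ Γ.geodesicInterval a a') :
      Γ.HarmonicOn (g b) (Γ.ball p (2 * (R / 4))) := by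
    obtain ⟨hxp, hpb⟩ := hab p hp
    have hxp' : (Γ.graph.dist x p : ℝ) ≤ 2 * R := by exact_mod_cast hxp
    have hpb' : (R : ℝ) ≤ 2 * Γ.graph.dist p b := by exact_mod_cast hpb
    refine hg.harmonicOn hΓ hb (Γ.ball_subset_ball (by linarith)) ?_
    rw [mem_ball]
    linarith
  -- Steps of length `s` are either at most `1` or less than `R / 4`, and 16 of them suffice.
  refine le_pow_mul_of_geodesicInterval (s := (R + 7) / 8) (zero_le_one.trans hK)
    (fun p hp q hq hpq => harnack (R / 4) (by positivity) (g b) p q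
      (hg.nonneg hΓ (hΓ.finite_ball x _) h_ne hb)
      (harmonic hp) (harmonic hq) ?_) (by omega)
  rcases (by omega : Γ.graph.dist p q ≤ 1 ∨ 4 * Γ.graph.dist p q < R) with h | h
  · exact Or.inl h
  · right
    rw [lt_div_iff₀' (by norm_num)]
    exact_mod_cast h

theorem exists_green_le_green_of_dist_eq (hp : Γ.ControlledWeights) (hH : Γ.Harnack) :
    ∃ C : ℝ, 0 < C ∧ ∀ (x : V) (R : ℕ), 1 ≤ R → Γ.ball x (3 * R) ≠ Set.univ →
      ∀ g, Γ.IsGreenFunction (Γ.ball x (3 * R)) g → ∀ y z : V, Γ.graph.dist x y = R →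
      Γ.graph.dist x z = 2 * R → g x y ≤ C * g x z := by
  obtain ⟨C, hC, harnack⟩ := exists_geodesicHarnack hp hH
  refine ⟨C ^ 2, by positivity, fun x R hR h_ne g hg y z hy hz => ?_⟩
  have geodesicHarnack := harnack x R hR h_ne g hg
  by_cases far : ∀ p ∈ Γ.geodesicInterval x z, R ≤ 2 * Γ.graph.dist p y
  · have hU := hp.isLocallyFinite.finite_ball x (3 * R)
    have dist_xx : Γ.graph.dist x x = 0 := SimpleGraph.dist_self
    have hxU : x ∈ Γ.ball x (3 * R) := Γ.mem_ball_three_mul hR (by omega)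
    have hyU : y ∈ Γ.ball x (3 * R) := Γ.mem_ball_three_mul hR (by omega)
    have hzU : z ∈ Γ.ball x (3 * R) := Γ.mem_ball_three_mul hR (by omega)
    exact geodesicHarnack.le_of_far hC.le (hg.symm hU hxU hyU) (hg.symm hU hyU hzU)
      (hg.symm hU hzU hxU) hy hz far
  · push Not at far
    obtain ⟨p, hp, hpy⟩ := far
    exact geodesicHarnack.le_of_near hC.le hy hz hp hpy

end Harnack

section AntiDoubling

variable {V : Type*} [Nontrivial V] [MeasurableSpace V] [DiscreteMeasurableSpace V]
  {Γ : WeightedGraph V}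

theorem F_mono {R S : ℝ} (h : R ≤ S) : Γ.F R ≤ Γ.F S :=
  iInf_mono fun x => Γ.meanExit_mono x (Γ.ball_mono x h)

theorem F_le_meanExit {x y : V} {R S : ℝ} (h : Γ.graph.dist x y + R ≤ S) :
    Γ.F R ≤ Γ.meanExit y (Γ.ball x S) :=
  (iInf_le _ y).trans (Γ.meanExit_mono y (Γ.ball_subset_ball h))

theorem pow_mul_F_le {a : ℕ} (ha : 1 ≤ a) {B : ℝ≥0∞}
    (h : ∀ R : ℕ, 1 ≤ R → B * Γ.F R ≤ Γ.F (a * (R : ℝ))) (k : ℕ) {R : ℕ} (hR : 1 ≤ R) :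
    B ^ k * Γ.F R ≤ Γ.F ((a : ℝ) ^ k * R) := by
  induction k with
  | zero => simp
  | succ k ih =>
    calc B ^ (k + 1) * Γ.F R = B * (B ^ k * Γ.F R) := by rw [pow_succ', mul_assoc]
      _ ≤ B * Γ.F ((a ^ k * R : ℕ) : ℝ) := by
        push_cast
        gcongr
      _ ≤ Γ.F (a * ((a ^ k * R : ℕ) : ℝ)) := h _ (Nat.mul_pos (pow_pos ha k) hR)
      _ = Γ.F ((a : ℝ) ^ (k + 1) * R) := by
        push_cast
        rw [pow_succ', mul_assoc]

/-- Rounding a real radius `R` up to an integer costs at most a factor `2`, which is less than the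
gain `(B / a) ^ k` of sufficiently many iterations. -/
theorem exists_mul_F_le_of_nat {a : ℕ} (ha : 1 ≤ a) {B : ℝ} (haB : a < B)
    (h : ∀ R : ℕ, 1 ≤ R → ENNReal.ofReal B * Γ.F R ≤ Γ.F (a * (R : ℝ))) :
    ∃ A' B' : ℝ, 1 < A' ∧ A' < B' ∧
      ∀ R : ℝ, 1 ≤ R → ENNReal.ofReal B' * Γ.F R ≤ Γ.F (A' * R) := by
  have ha1 : (1 : ℝ) ≤ a := by exact_mod_cast ha
  obtain ⟨k, hk⟩ := pow_unbounded_of_one_lt 2 ((one_lt_div (zero_lt_one.trans_le ha1)).2 haB)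
  rw [div_pow, lt_div_iff₀ (by positivity)] at hk
  have one_le_pow : (1 : ℝ) ≤ a ^ k := one_le_pow₀ ha1
  refine ⟨2 * a ^ k, B ^ k, by linarith, hk, fun R hR => ?_⟩
  have ceil_le : (⌈R⌉₊ : ℝ) ≤ 2 * R := by
    linarith [Nat.ceil_lt_add_one (zero_le_one.trans hR)]
  calc ENNReal.ofReal (B ^ k) * Γ.F R ≤ ENNReal.ofReal B ^ k * Γ.F (⌈R⌉₊ : ℝ) := by
        rw [ENNReal.ofReal_pow (by linarith)]
        gcongr
        exact F_mono (Nat.le_ceil R)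
    _ ≤ Γ.F ((a : ℝ) ^ k * ⌈R⌉₊) := pow_mul_F_le ha h k (Nat.one_le_ceil_iff.2 (by linarith))
    _ ≤ Γ.F ((a : ℝ) ^ k * (2 * R)) := F_mono (by gcongr)
    _ = Γ.F (2 * (a : ℝ) ^ k * R) := by rw [mul_left_comm, mul_assoc]

variable [Countable V]

theorem meanExit_ball_add_le (hΓ : Γ.IsLocallyFinite) {x z : V} {R : ℕ} {S : ℝ} (hRS : R ≤ S)
    (hz : z ∈ Γ.ball x R) {m : ℝ≥0∞}
    (hm : ∀ y, Γ.graph.dist x y = R → m ≤ Γ.meanExit y (Γ.ball x S)) :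
    Γ.meanExit z (Γ.ball x R) + m ≤ Γ.meanExit z (Γ.ball x S) := by
  by_cases hS : Γ.ball x S = Set.univ
  · rw [hS, meanExit_univ]
    exact le_top
  have hRS_ball : Γ.ball x R ⊆ Γ.ball x S := Γ.ball_mono x hRS
  have hR : Γ.ball x R ≠ Set.univ := mt (Set.eq_univ_of_subset hRS_ball) hS
  have hS_fin := hΓ.finite_ball x S
  have meanExit_S_ne_top := meanExit_ne_top hΓ hS_fin hS
  have hm_ne_top : m ≠ ⊤ := by
    obtain ⟨y, hy⟩ := (Set.ne_univ_iff_exists_notMem _).1 hR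
    rw [mem_ball_natCast, not_lt] at hy
    obtain ⟨c, hc, -⟩ := Γ.exists_dist_eq hy
    exact ne_top_of_le_ne_top (meanExit_S_ne_top c) (hm c hc)
  rw [← ofReal_meanExitReal hΓ (hΓ.finite_ball x R) hR, ← ofReal_meanExitReal hΓ hS_fin hS,
    ← ENNReal.ofReal_toReal hm_ne_top,
    ← ENNReal.ofReal_add (meanExitReal_nonneg _ _) ENNReal.toReal_nonneg]
  refine ENNReal.ofReal_le_ofReal (meanExitReal_add_le hΓ hS_fin hS hRS_ball
    (w := fun _ => m.toReal) ((harmonicOn_iff hΓ).2 fun y _ => laplacian_const _ y)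
    (fun a ha y hy hay => ?_) hz)
  exact ENNReal.toReal_mono (meanExit_S_ne_top y) (hm y (Γ.dist_eq_of_adj_ball ha hy hay))

theorem two_mul_F_le_E (hΓ : Γ.IsLocallyFinite) (x : V) {R : ℕ} (hR : 1 ≤ R) :
    2 * Γ.F R ≤ Γ.E x (2 * R) := by
  have hx : x ∈ Γ.ball x R := by
    rw [mem_ball_natCast, SimpleGraph.dist_self]
    exact hR
  calc 2 * Γ.F R = Γ.F R + Γ.F R := two_mul _
    _ ≤ Γ.E x R + Γ.F R := by
      gcongr
      exact iInf_le _ x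
    _ ≤ Γ.E x (2 * R) := meanExit_ball_add_le hΓ (by linarith [Nat.cast_nonneg (α := ℝ) R]) hx
      fun y hy => F_le_meanExit (by rw [hy, two_mul])

theorem mul_green_le_meanExitReal (hΓ : Γ.IsLocallyFinite) {U : Set V} (hU : U.Finite)
    (hU_ne : U ≠ Set.univ) {g : V → V → ℝ} (hg : Γ.IsGreenFunction U g) {x : V} (hx : x ∈ U)
    {R : ℕ} {t : ℝ} (h : ∀ y, Γ.graph.dist x y = R → t * g x y ≤ Γ.meanExitReal U y) {z : V}
    (hz : R ≤ Γ.graph.dist x z) : t * g x z ≤ Γ.meanExitReal U z := by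
  let A : Set V := {a ∈ U | R < Γ.graph.dist x a}
  have hAU : A ⊆ U := Set.sep_subset U _
  have hA : A.Finite := hU.subset hAU
  have hA_ne : A ≠ Set.univ := mt (Set.eq_univ_of_subset hAU) hU_ne
  have le_of_notMem_U {y : V} (hy : y ∉ U) : t * g x y ≤ Γ.meanExitReal U y := by
    rw [hg.eq_zero_of_notMem x hx y hy, mul_zero, meanExitReal_of_notMem hy]
  by_cases hzU : z ∈ U
  swap
  · exact le_of_notMem_U hzU
  rcases hz.eq_or_lt with hz | hz
  · exact h z hz.symm
  refine le_of_laplacian_le hΓ hA hA_ne (f := t • g x) (fun a ⟨haU, ha⟩ => ?_)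
    (fun a ⟨_, ha⟩ y hy hay => ?_) z ⟨hzU, hz⟩
  · have hax : a ≠ x := by
      rintro rfl
      simp at ha
    rw [laplacian_smul, hg.laplacian_of_ne x hx a haU hax, mul_zero,
      laplacian_meanExitReal hΓ hU hU_ne haU]
    exact zero_le_one
  · by_cases hyU : y ∈ U
    · have triangle := Γ.dist_triangle x y a
      have dist_ya := Γ.dist_le_one_of_adj (Γ.adj_comm.1 hay)
      have hyR : Γ.graph.dist x y ≤ R := not_lt.1 fun hyR => hy ⟨hyU, hyR⟩
      exact h y (by omega)
    · exact le_of_notMem_U hyU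

theorem meanExitReal_ball_add_mul_green_le (hΓ : Γ.IsLocallyFinite) {U : Set V} (hU : U.Finite)
    (hU_ne : U ≠ Set.univ) {g : V → V → ℝ} (hg : Γ.IsGreenFunction U g) {x : V} (hx : x ∈ U)
    {R : ℕ} (hR : 1 ≤ R) {t : ℝ}
    (h : ∀ y, Γ.graph.dist x y = R → t * g x y ≤ Γ.meanExitReal U y) {z : V}
    (hxz : 2 * R ≤ Γ.graph.dist x z) (hzU : Γ.ball z R ⊆ U) :
    Γ.meanExitReal (Γ.ball z R) z + t * g x z ≤ Γ.meanExitReal U z := by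
  have hz : z ∈ Γ.ball z R := by
    rw [mem_ball_natCast, SimpleGraph.dist_self]
    exact hR
  have hx_notMem : x ∉ Γ.ball z R := by
    rw [mem_ball_natCast, Γ.dist_comm]
    omega
  have harmonic : Γ.HarmonicOn (t • g x) (Γ.ball z R) := (harmonicOn_iff hΓ).2 fun a ha => by
    rw [laplacian_smul, (harmonicOn_iff hΓ).1 (hg.harmonicOn hΓ hx hzU hx_notMem) a ha, mul_zero]
  refine meanExitReal_add_le hΓ hU hU_ne hzU (w := t • g x) harmonic (fun a ha y hy hay => ?_) hz
  have triangle := Γ.dist_triangle x y z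
  have dist_yz := (Γ.dist_comm y z).trans (Γ.dist_eq_of_adj_ball ha hy hay)
  exact mul_green_le_meanExitReal hΓ hU hU_ne hg hx h (by omega)

theorem one_add_mul_toReal_F_le_meanExitReal (hΓ : Γ.IsLocallyFinite) {x z : V} {R : ℕ}
    (hR : 1 ≤ R) (hz : Γ.graph.dist x z = 2 * R) (hU_ne : Γ.ball x (3 * R) ≠ Set.univ)
    {g : V → V → ℝ} (hg : Γ.IsGreenFunction (Γ.ball x (3 * R)) g) {C : ℝ} (hC : 0 < C)
    (green_le : ∀ y, Γ.graph.dist x y = R → g x y ≤ C * g x z) :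
    (1 + 2 / C) * (Γ.F R).toReal ≤ Γ.meanExitReal (Γ.ball x (3 * R)) z := by
  have hU := hΓ.finite_ball x (3 * R)
  have hxU : x ∈ Γ.ball x (3 * R) := Γ.mem_ball_three_mul hR (by simp)
  have g_pos : 0 < g x z := hg.pos_of_mem_ball hΓ hU_ne (Γ.mem_ball_three_mul hR hz.le)
  have hzU : Γ.ball z R ⊆ Γ.ball x (3 * R) := Γ.ball_subset_ball (by
    rw [hz]
    push_cast
    linarith)
  have hz_ne : Γ.ball z R ≠ Set.univ := mt (Set.eq_univ_of_subset hzU) hU_ne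
  have F_le_meanExitReal : (Γ.F R).toReal ≤ Γ.meanExitReal (Γ.ball z R) z :=
    ENNReal.toReal_mono (meanExit_ne_top hΓ (hΓ.finite_ball z R) hz_ne z) (iInf_le _ z)
  -- `t • g x` equals `2 F(R) / C` at `z`, hence it is at most `2 F(R)` at distance `R` from `x`.
  let t := 2 * (Γ.F R).toReal / (C * g x z)
  have le_on_sphere (y : V) (hy : Γ.graph.dist x y = R) :
      t * g x y ≤ Γ.meanExitReal (Γ.ball x (3 * R)) y := calc
    t * g x y ≤ t * (C * g x z) := mul_le_mul_of_nonneg_left (green_le y hy) (by positivity)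
    _ = (2 * Γ.F R).toReal := by
      rw [div_mul_cancel₀ _ (by positivity), ENNReal.toReal_mul, ENNReal.toReal_ofNat]
    _ ≤ Γ.meanExitReal (Γ.ball x (3 * R)) y :=
      ENNReal.toReal_mono (meanExit_ne_top hΓ hU hU_ne y) ((two_mul_F_le_E hΓ y hR).trans
        (Γ.meanExit_mono y (Γ.ball_subset_ball (by rw [hy]; linarith))))
  calc (1 + 2 / C) * (Γ.F R).toReal
      = (Γ.F R).toReal + t * g x z := by
        simp only [t]
        field_simp
    _ ≤ Γ.meanExitReal (Γ.ball z R) z + t * g x z := by gcongr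
    _ ≤ Γ.meanExitReal (Γ.ball x (3 * R)) z :=
      meanExitReal_ball_add_mul_green_le hΓ hU hU_ne hg hxU hR le_on_sphere hz.ge hzU

theorem exists_one_add_mul_F_le_meanExit (hp : Γ.ControlledWeights) (hH : Γ.Harnack) :
    ∃ c : ℝ, 0 < c ∧ ∀ (x z : V) (R : ℕ), 1 ≤ R → Γ.graph.dist x z = 2 * R →
      ENNReal.ofReal (1 + c) * Γ.F R ≤ Γ.meanExit z (Γ.ball x (3 * R)) := by
  have hΓ := hp.isLocallyFinite
  obtain ⟨C, hC, green_le⟩ := exists_green_le_green_of_dist_eq hp hH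
  refine ⟨2 / C, by positivity, fun x z R hR hz => ?_⟩
  by_cases hU_ne : Γ.ball x (3 * R) = Set.univ
  · rw [hU_ne, meanExit_univ]
    exact le_top
  have hU := hΓ.finite_ball x (3 * R)
  obtain ⟨g, hg⟩ := exists_isGreenFunction hΓ hU hU_ne
  have F_ne_top : Γ.F R ≠ ⊤ := ne_top_of_le_ne_top (meanExit_ne_top hΓ hU hU_ne x)
    (F_le_meanExit (by rw [SimpleGraph.dist_self]; push_cast; linarith))
  rw [← ofReal_meanExitReal hΓ hU hU_ne, ← ENNReal.ofReal_toReal F_ne_top,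
    ← ENNReal.ofReal_mul (by positivity)]
  exact ENNReal.ofReal_le_ofReal (one_add_mul_toReal_F_le_meanExitReal hΓ hR hz hU_ne hg hC
    fun y hy => green_le x R hR hU_ne g hg y z hy hz)

theorem exists_three_lt_mul_F_le (hp : Γ.ControlledWeights) (hH : Γ.Harnack) :
    ∃ B : ℝ, 3 < B ∧
      ∀ R : ℕ, 1 ≤ R → ENNReal.ofReal B * Γ.F (R : ℝ) ≤ Γ.F (3 * (R : ℝ)) := by
  have hΓ := hp.isLocallyFinite
  obtain ⟨c, hc, one_add_mul_F_le⟩ := exists_one_add_mul_F_le_meanExit hp hH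
  refine ⟨3 + c, by linarith, fun R hR => le_iInf fun x => ?_⟩
  have hx : x ∈ Γ.ball x (2 * R : ℕ) := by
    rw [mem_ball_natCast, SimpleGraph.dist_self]
    omega
  calc ENNReal.ofReal (3 + c) * Γ.F R
      = 2 * Γ.F R + ENNReal.ofReal (1 + c) * Γ.F R := by
        rw [← add_mul, ← ENNReal.ofReal_ofNat 2, ← ENNReal.ofReal_add (by norm_num) (by linarith)]
        ring_nf
    _ ≤ Γ.E x (2 * R : ℕ) + ENNReal.ofReal (1 + c) * Γ.F R := by
        push_cast
        gcongr
        exact two_mul_F_le_E hΓ x hR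
    _ ≤ Γ.E x (3 * R) := meanExit_ball_add_le hΓ (by push_cast; gcongr; norm_num) hx
        fun z hz => one_add_mul_F_le x z R hR hz

end AntiDoubling

end WeightedGraph

theorem mainTheorem6_general {V : Type*} [Countable V] [Nontrivial V] [MeasurableSpace V]
    [DiscreteMeasurableSpace V] (Γ : WeightedGraph V)
    (hp : Γ.ControlledWeights) (hH : Γ.Harnack) :
    (∃ A B : ℝ, 1 < A ∧ A < B ∧
      ∀ R : ℝ, 1 ≤ R → ENNReal.ofReal B * Γ.F R ≤ Γ.F (A * R)) ∧
    (∃ B : ℝ, 3 < B ∧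
      ∀ R : ℕ, 1 ≤ R → ENNReal.ofReal B * Γ.F (R : ℝ) ≤ Γ.F (3 * (R : ℝ))) := by
  obtain ⟨B, hB, mul_F_le⟩ := WeightedGraph.exists_three_lt_mul_F_le hp hH
  refine ⟨WeightedGraph.exists_mul_F_le_of_nat (a := 3) (by norm_num) hB ?_, B, hB, mul_F_le⟩
  exact_mod_cast mul_F_le

theorem mainTheorem6 {V : Type*} [Countable V] [Infinite V] [MeasurableSpace V]
    [DiscreteMeasurableSpace V] (Γ : WeightedGraph V)
    (hp : Γ.ControlledWeights) (hVD : Γ.VolumeDoubling) (hE : Γ.HomogeneousExit)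
    (hH : Γ.Harnack) :
    (∃ A B : ℝ, 1 < A ∧ A < B ∧
      ∀ R : ℝ, 1 ≤ R → ENNReal.ofReal B * Γ.F R ≤ Γ.F (A * R)) ∧
    (∃ B : ℝ, 3 < B ∧
      ∀ R : ℕ, 1 ≤ R → ENNReal.ofReal B * Γ.F (R : ℝ) ≤ Γ.F (3 * (R : ℝ))) :=
  mainTheorem6_general Γ hp hH
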